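/- Let $(\mathcal A,\varphi)$ be a noncommutative probability space, i.e. a complex unital algebra with a unital linear functional. An exchangeability system $\mathcal E$ for $(\mathcal A,\varphi)$ consists of a noncommutative probability space $(\mathcal U,\tilde\varphi)$ and unital embeddings $X\mapsto X^{(k)}$ of $\mathcal A$ into $\mathcal U$ ($k\in\mathbb N$) with $\tilde\varphi(X^{(k)})=\varphi(X)$, such that $\tilde\varphi(X_1^{(i_1)}\cdots X_n^{(i_n)})=\tilde\varphi(X_1^{(\sigma(i_1))}\cdots X_n^{(\sigma(i_n))})$ for every permutation $\sigma$ of $\mathbb N$. For a set partition $\pi\in\Pi_n$ of $\{1,\dots,n\}$, the partitioned moment $\varphi_\pi(X_1,\dots,X_n)$ is the common value of $\tilde\varphi(X_1^{(h(1))}\cdots X_n^{(h(n))})$ over all $h:\{1,\dots,n\}\to\mathbb N$ such that $h(i)=h(j)$ if and only if $i,j$ lie in the same block of $\pi$. The partitioned cumulant is $$K_\pi(X_1,\dots,X_n)=\sum_{\sigma\le\pi}\varphi_\sigma(X_1,\dots,X_n)\,\mu(\sigma,\pi),$$ where $\Pi_n$ is ordered by refinement and $\mu$ is its Möbius function. The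 copies $\mathcal A^{(k)}$ are free if $\tilde\varphi(Y_1\cdots Y_m)=0$ whenever $m\ge1$, $Y_j\in\mathcal A^{(k_j)}$, $\tilde\varphi(Y_j)=0$ and $k_j\ne k_{j+1}$. A partition $\pi$ has a crossing if there are $i<j<k<l$ with $i\sim_\pi k$, $j\sim_\pi l$, $i\not\sim_\pi j$; otherwise $\pi$ is noncrossing. $NC_n$ is the poset of noncrossing partitions and $\mu_{NC}$ its Möbius function. **Proposition.** The free product $\mathcal U=\bigstar_{k\in\mathbb N}\mathcal A$ of copies of $\mathcal A$, with the free product functional $\tilde\varphi=\bigstar_k\varphi$, is an exchangeability system for $(\mathcal A,\varphi)$ whose copies of $\mathcal A$ are free (the free exchangeability system). For it, and for every exchangeability system for $(\mathcal A,\varphi)$ whose copies of $\mathcal A$ are free, the following hold for all $n$ and all $X_1,\dots,X_n\in\mathcal A$. 1. If $\pi\in\Pi_n$ has a crossing, then $K_\pi(X_1,\dots,X_n)=0$. 2. For every $\pi\in\Pi_n$, $$\varphi_\pi(X_1,\dots,X_n)=\sum_{\sigma\in NC_n,\ \sigma\le\pi}K_\sigma(X_1,\dots,X_n);$$ in particular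 $\varphi(X_1\cdots X_n)=\sum_{\sigma\in NC_n}K_\sigma(X_1,\dots,X_n)$. 3. (Speicher's formula) For every $\pi\in NC_n$, $$K_\pi(X_1,\dots,X_n)=\sum_{\sigma\in NC_n,\ \sigma\le\pi}\varphi_\sigma(X_1,\dots,X_n)\,\mu_{NC}(\sigma,\pi),$$ where $\varphi_\sigma(X_1,\dots,X_n)=\prod_{B\in\sigma}\varphi\bigl(\prod_{i\in B}X_i\bigr)$ for $\sigma\in NC_n$, the products over $B$ being taken in increasing order of the indices. -/

import Mathlib

universe u v w

namespace FreeCumulants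

open Finset

/-! ### Noncommutative probability and freeness -/

/-- Freeness of a family of (unital) subalgebras with respect to `ψ`: `ψ` vanishes on every
nonempty alternating product of centred elements.  A letter of the word `l` is a pair `(k, x)`
with `x` in the `k`-th subalgebra. -/
def AreFree {U : Type v} [Ring U] [Algebra ℂ U] {κ : Type w}
    (ψ : U →ₗ[ℂ] ℂ) (S : κ → Subalgebra ℂ U) : Prop :=
  ∀ l : List (κ × U), l ≠ [] → l.IsChain (fun p q => p.1 ≠ q.1) →
    (∀ p ∈ l, p.2 ∈ S p.1 ∧ ψ p.2 = 0) → ψ (l.map Prod.snd).prod = 0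

/-- An exchangeability system for the noncommutative probability space `(A, φ)`: a noncommutative
probability space `(space, state)` with a sequence of state-preserving embeddings
`X ↦ copy k X = X^(k)` whose images are interchangeable. -/
structure ExchangeabilitySystem {A : Type u} [Ring A] [Algebra ℂ A] (φ : A →ₗ[ℂ] ℂ) where
  space : Type v
  [ring : Ring space]
  [algebra : Algebra ℂ space]
  state : space →ₗ[ℂ] ℂ
  state_one : state 1 = 1
  copy : ℕ → A →ₐ[ℂ] space
  copy_injective : ∀ k, Function.Injective (copy k)
  state_copy : ∀ k a, state (copy k a) = φ a
  interchangeable : ∀ (n : ℕ) (X : Fin n → A) (i : Fin n → ℕ) (σ : Equiv.Perm ℕ),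
    state (List.ofFn fun j => copy (i j) (X j)).prod =
      state (List.ofFn fun j => copy (σ (i j)) (X j)).prod

attribute [instance] ExchangeabilitySystem.ring ExchangeabilitySystem.algebra

/-- The copies `A_k = A^(k)` of `A` are free. -/
def ExchangeabilitySystem.IsFree {A : Type u} [Ring A] [Algebra ℂ A] {φ : A →ₗ[ℂ] ℂ}
    (E : ExchangeabilitySystem.{u, v} φ) : Prop :=
  AreFree E.state fun k => (E.copy k).range

/-! ### Set partitions -/

/-- The set partitions of an `n`-element linearly ordered set, ordered by refinement. -/
abbrev SetPartition (n : ℕ) : Type := Finpartition (univ : Finset (Fin n))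

/-- `i` and `j` lie in the same block of `π`. -/
def SameBlock {n : ℕ} (π : SetPartition n) (i j : Fin n) : Prop :=
  ∃ B ∈ π.parts, i ∈ B ∧ j ∈ B

def HasCrossing {n : ℕ} (π : SetPartition n) : Prop :=
  ∃ i j k l : Fin n, i < j ∧ j < k ∧ k < l ∧
    SameBlock π i k ∧ SameBlock π j l ∧ ¬ SameBlock π i j

/-- The poset of noncrossing partitions, with the refinement order. -/
abbrev NoncrossingPartition (n : ℕ) : Type := {π : SetPartition n // ¬ HasCrossing π}

/-- The Möbius function of a finite poset. -/
noncomputable def moebius {P : Type w} [PartialOrder P] [Fintype P] (x y : P) : ℂ :=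
  letI : DecidableEq P := Classical.decEq P
  letI : DecidableLE P := Classical.decRel _
  letI : DecidableLT P := Classical.decRel _
  letI : LocallyFiniteOrder P := Fintype.toLocallyFiniteOrder
  IncidenceAlgebra.mu ℂ x y

noncomputable instance noncrossingFintype (n : ℕ) : Fintype (NoncrossingPartition n) :=
  Fintype.ofFinite _

open Classical in
/-- The noncrossing partitions `σ ≤ π`. -/
noncomputable def noncrossingBelow {n : ℕ} (π : SetPartition n) :
    Finset (NoncrossingPartition n) :=
  {σ : NoncrossingPartition n | σ.1 ≤ π}

/-- An index map `[n] → ℕ` with kernel `π`: every point is sent to the minimum of its block. -/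
def blockIndex {n : ℕ} (π : SetPartition n) (i : Fin n) : ℕ :=
  (((π.part i).min' ((π.part_nonempty).2 (mem_univ i)) : Fin n) : ℕ)

theorem sameBlock_iff_part_eq {n : ℕ} (π : SetPartition n) (i j : Fin n) :
    SameBlock π i j ↔ π.part i = π.part j := by
  rw [← π.mem_part_iff_part_eq_part (mem_univ i) (mem_univ j), π.mem_part_iff_exists]
  rfl

theorem blockIndex_eq_iff {n : ℕ} (π : SetPartition n) (i j : Fin n) :
    blockIndex π i = blockIndex π j ↔ SameBlock π i j := by
  rw [sameBlock_iff_part_eq]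
  constructor
  · intro h
    have h' := Fin.val_injective h
    have hi := (π.part i).min'_mem ((π.part_nonempty).2 (mem_univ i))
    have hj := (π.part j).min'_mem ((π.part_nonempty).2 (mem_univ j))
    rw [h'] at hi
    exact π.eq_of_mem_parts (π.part_mem.2 (mem_univ i)) (π.part_mem.2 (mem_univ j)) hi hj
  · intro h
    unfold blockIndex
    congr 2

/-! ### Partitioned moments and cumulants -/

namespace ExchangeabilitySystem

variable {A : Type u} [Ring A] [Algebra ℂ A] {φ : A →ₗ[ℂ] ℂ}

/-- The partitioned moment `φ_π(X_1, …, X_n)`: the expectation of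
`X_1^(h 1) X_2^(h 2) ⋯ X_n^(h n)` for an index map `h` with kernel `π`
(see `moment_eq_of_ker` for the independence of the choice of `h`). -/
noncomputable def moment (E : ExchangeabilitySystem.{u, v} φ) {n : ℕ} (π : SetPartition n)
    (X : Fin n → A) : ℂ :=
  E.state (List.ofFn fun j => E.copy (blockIndex π j) (X j)).prod

open Classical in
/-- The partitioned cumulant
`K_π(X_1, …, X_n) = ∑_{σ ≤ π} φ_σ(X_1, …, X_n) μ(σ, π)`, with the Möbius function of the lattice of
all set partitions. -/
noncomputable def cumulant (E : ExchangeabilitySystem.{u, v} φ) {n : ℕ} (π : SetPartition n)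
    (X : Fin n → A) : ℂ :=
  ∑ σ : SetPartition n with σ ≤ π, E.moment σ X * moebius σ π

theorem moment_eq_of_ker (E : ExchangeabilitySystem.{u, v} φ) {n : ℕ} (π : SetPartition n)
    (X : Fin n → A) (h : Fin n → ℕ) (hh : ∀ i j, h i = h j ↔ SameBlock π i j) :
    E.state (List.ofFn fun j => E.copy (h j) (X j)).prod = E.moment π X := by
  classical
  have key : ∀ i j, h i = h j ↔ blockIndex π i = blockIndex π j := fun i j =>
    (hh i j).trans (blockIndex_eq_iff π i j).symm
  obtain ⟨N, hN⟩ : ∃ N, ∀ i, h i < N ∧ blockIndex π i < N := by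
    refine ⟨∑ i, (h i + blockIndex π i + 1), fun i => ?_⟩
    have := Finset.single_le_sum (f := fun i => h i + blockIndex π i + 1)
      (fun _ _ => Nat.zero_le _) (mem_univ i)
    omega
  let p : Fin N → Prop := fun x => ∃ i, h i = x
  let q : Fin N → Prop := fun x => ∃ i, blockIndex π i = x
  let f : {x // p x} → {x // q x} := fun x =>
    ⟨⟨blockIndex π x.2.choose, (hN _).2⟩, x.2.choose, rfl⟩
  have hf : Function.Bijective f := by
    constructor
    · intro x y hxy
      have h1 : blockIndex π x.2.choose = blockIndex π y.2.choose :=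
        congrArg (fun z : {x // q x} => (z.1 : ℕ)) hxy
      have h2 := (key _ _).2 h1
      rw [x.2.choose_spec, y.2.choose_spec] at h2
      exact Subtype.ext (Fin.ext h2)
    · rintro ⟨y, i, hi⟩
      refine ⟨⟨⟨h i, (hN i).1⟩, i, rfl⟩, ?_⟩
      apply Subtype.ext
      apply Fin.ext
      rw [← hi]
      apply (key _ _).1
      exact Exists.choose_spec (p := fun j => h j = h i) ⟨i, rfl⟩
  let e : Equiv.Perm (Fin N) := (Equiv.ofBijective f hf).extendSubtype
  let σ : Equiv.Perm ℕ := e.extendDomain Fin.equivSubtype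
  have hσ : ∀ i, σ (h i) = blockIndex π i := by
    intro i
    have hpi : p ⟨h i, (hN i).1⟩ := ⟨i, rfl⟩
    have h1 : σ ((Fin.equivSubtype (⟨h i, (hN i).1⟩ : Fin N) : {x // x < N}) : ℕ) =
        (Fin.equivSubtype (e ⟨h i, (hN i).1⟩) : {x // x < N}) :=
      Equiv.Perm.extendDomain_apply_image _ _ _
    have h2 : e ⟨h i, (hN i).1⟩ = (f ⟨_, hpi⟩).1 :=
      Equiv.extendSubtype_apply_of_mem _ _ hpi
    rw [h2] at h1
    refine h1.trans ?_
    apply (key _ _).1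
    exact Exists.choose_spec (p := fun j => h j = h i) ⟨i, rfl⟩
  rw [E.interchangeable n X h σ]
  simp only [hσ]
  rfl

end ExchangeabilitySystem

/-- The ordered product `∏_{i ∈ B} X_i`, the indices of `B` being taken in increasing order. -/
noncomputable def orderedProd {A : Type u} [Ring A] {n : ℕ} (B : Finset (Fin n))
    (X : Fin n → A) : A :=
  (B.sort.map X).prod

/-! ### The free product state -/

/-- The free product of countably many copies of the unital algebra `A`. -/
abbrev FreeProd (A : Type u) [Ring A] [Algebra ℂ A] : Type u :=
  LinearAlgebra.FreeProduct ℂ (fun _ : ℕ => A)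

/-- The canonical map of `A` onto its `k`-th copy in the free product. -/
noncomputable abbrev incl (A : Type u) [Ring A] [Algebra ℂ A] (k : ℕ) : A →ₐ[ℂ] FreeProd A :=
  LinearAlgebra.FreeProduct.ι ℂ (fun _ : ℕ => A) k

/-- `ψ` is the free product of copies of `φ`: it is unital, restricts to `φ` on every copy of `A`,
and the copies are free with respect to it. -/
structure IsFreeProductState {A : Type u} [Ring A] [Algebra ℂ A] (φ : A →ₗ[ℂ] ℂ)
    (ψ : FreeProd A →ₗ[ℂ] ℂ) : Prop where
  map_one : ψ 1 = 1
  map_incl : ∀ k a, ψ (incl A k a) = φ a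
  areFree : AreFree ψ fun k => (incl A k).range

/-- A functional that restricts to `φ` on free copies of `A` is determined by `φ` on the products of
elements of the copies. -/
theorem AreFree.unique {A : Type u} [Ring A] [Algebra ℂ A] {φ : A →ₗ[ℂ] ℂ} (hφ : φ 1 = 1)
    {U : Type v} [Ring U] [Algebra ℂ U] {V : Type w} [Ring V] [Algebra ℂ V]
    (ψ : U →ₗ[ℂ] ℂ) (χ : V →ₗ[ℂ] ℂ) (c : ℕ → A →ₐ[ℂ] U) (d : ℕ → A →ₐ[ℂ] V)
    (hψ1 : ψ 1 = 1) (hχ1 : χ 1 = 1)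
    (hψ : ∀ k a, ψ (c k a) = φ a) (hχ : ∀ k a, χ (d k a) = φ a)
    (hψf : AreFree ψ fun k => (c k).range) (hχf : AreFree χ fun k => (d k).range)
    (l : List (ℕ × A)) :
    ψ (l.map fun p => c p.1 p.2).prod = χ (l.map fun p => d p.1 p.2).prod := by
  induction hn : l.length using Nat.strong_induction_on generalizing l with
  | _ n ih =>
  by_cases hch : l.IsChain (fun p q => p.1 ≠ q.1)
  swap
  · have : ∃ l₁ l₂ k a b, l = l₁ ++ (k, a) :: (k, b) :: l₂ := by
      clear ih hn
      induction l with
      | nil => exact absurd List.IsChain.nil hch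
      | cons x t iht =>
        by_cases ht : t.IsChain (fun p q => p.1 ≠ q.1)
        · cases t with
          | nil => exact absurd (List.IsChain.singleton x) hch
          | cons y t =>
            have hxy : x.1 = y.1 := by
              by_contra h
              exact hch (List.IsChain.cons_cons h ht)
            refine ⟨[], t, x.1, x.2, y.2, ?_⟩
            rw [List.nil_append]
            nth_rewrite 2 [hxy]
            rfl
        · obtain ⟨l₁, l₂, k, a, b, h⟩ := iht ht
          exact ⟨x :: l₁, l₂, k, a, b, by rw [h]; rfl⟩
    obtain ⟨l₁, l₂, k, a, b, rfl⟩ := this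
    have := ih (l₁ ++ (k, a * b) :: l₂).length (by simp at hn ⊢; omega) _ rfl
    simpa [mul_assoc] using this
  · have main : ∀ (l₂ l₁ : List (ℕ × A)), (l₁ ++ l₂).length = n →
        (l₁ ++ l₂).IsChain (fun p q => p.1 ≠ q.1) → (∀ p ∈ l₁, φ p.2 = 0) →
        ψ ((l₁ ++ l₂).map fun p => c p.1 p.2).prod =
          χ ((l₁ ++ l₂).map fun p => d p.1 p.2).prod := by
      intro l₂
      induction l₂ with
      | nil =>
        intro l₁ _ h hc
        rw [List.append_nil] at h ⊢
        rcases eq_or_ne l₁ [] with rfl | hne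
        · simp [hψ1, hχ1]
        have h1 := hψf (l₁.map fun p => (p.1, c p.1 p.2)) (by simpa using hne)
          (by rw [List.isChain_map]; exact h)
          (by
            intro p hp
            obtain ⟨q, hq, rfl⟩ := List.mem_map.1 hp
            exact ⟨⟨q.2, rfl⟩, by rw [hψ]; exact hc q hq⟩)
        have h2 := hχf (l₁.map fun p => (p.1, d p.1 p.2)) (by simpa using hne)
          (by rw [List.isChain_map]; exact h)
          (by
            intro p hp
            obtain ⟨q, hq, rfl⟩ := List.mem_map.1 hp
            exact ⟨⟨q.2, rfl⟩, by rw [hχ]; exact hc q hq⟩)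
        rw [List.map_map] at h1 h2
        exact h1.trans h2.symm
      | cons x t iht =>
        intro l₁ hlen h hc
        have e1 := iht (l₁ ++ [(x.1, x.2 - φ x.2 • 1)]) (by simpa using hlen)
          (by
            have hm : (List.map Prod.fst (l₁ ++ x :: t)).IsChain (· ≠ ·) := by
              rw [List.isChain_map]; exact h
            have : (List.map Prod.fst (l₁ ++ [(x.1, x.2 - φ x.2 • 1)] ++ t)).IsChain
                (· ≠ ·) := by simpa using hm
            rwa [List.isChain_map] at this)
          (by
            intro p hp
            rcases List.mem_append.1 hp with hp | hp
            · exact hc p hp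
            · rw [List.mem_singleton.1 hp]
              simp [hφ])
        have e2 := ih (l₁ ++ t).length (by simp at hlen ⊢; omega) (l₁ ++ t) rfl
        simp only [List.map_append, List.map_cons, List.map_nil, List.prod_append, List.prod_cons,
          List.prod_nil, map_sub, map_smul, map_one, mul_one, mul_sub, sub_mul, mul_assoc,
          mul_smul_comm, smul_mul_assoc] at e1 e2 ⊢
        rw [e2] at e1
        simpa using e1
    exact main l [] (by simpa using hn) (by simpa using hch) (by simp)

/-- The free product is spanned by the products of elements of the copies. -/
theorem span_products (A : Type u) [Ring A] [Algebra ℂ A] :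
    Submodule.span ℂ (Set.range fun l : List (ℕ × A) => (l.map fun p => incl A p.1 p.2).prod) =
      (⊤ : Submodule ℂ (FreeProd A)) := by
  classical
  let M : Submonoid (FreeProd A) :=
    { carrier := Set.range fun l : List (ℕ × A) => (l.map fun p => incl A p.1 p.2).prod
      one_mem' := ⟨[], rfl⟩
      mul_mem' := by
        rintro _ _ ⟨l, rfl⟩ ⟨m, rfl⟩
        exact ⟨l ++ m, by simp⟩ }
  have hS : Algebra.adjoin ℂ (M : Set (FreeProd A)) = ⊤ := by
    let S := Algebra.adjoin ℂ (M : Set (FreeProd A))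
    have hmem : ∀ k a, incl A k a ∈ S := fun k a =>
      Algebra.subset_adjoin ⟨[(k, a)], by simp⟩
    let g : FreeProd A →ₐ[ℂ] S := LinearAlgebra.FreeProduct.lift ℂ (fun _ : ℕ => A)
      (fun {k} => (incl A k).codRestrict S (hmem k))
    have hg : S.val.comp g = AlgHom.id ℂ _ := by
      have h1 := LinearAlgebra.FreeProduct.lift_unique ℂ (fun _ : ℕ => A)
        (fun {k} => incl A k) (S.val.comp g) (by
          intro k
          have := LinearAlgebra.FreeProduct.lift_comp_ι ℂ (fun _ : ℕ => A) (i := k)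
            (fun {k} => (incl A k).codRestrict S (hmem k))
          rw [AlgHom.comp_assoc]
          erw [this]
          rfl)
      have h2 := LinearAlgebra.FreeProduct.lift_unique ℂ (fun _ : ℕ => A)
        (fun {k} => incl A k) (AlgHom.id ℂ _) (by intro k; rfl)
      rw [h1, ← h2]
    rw [eq_top_iff]
    intro x _
    have := DFunLike.congr_fun hg x
    rw [← show ((g x : S) : FreeProd A) = x from this]
    exact (g x).2
  have h2 := Algebra.adjoin_eq_span ℂ (M : Set (FreeProd A))
  rw [hS, Submonoid.closure_eq] at h2
  exact h2.symm

theorem IsFreeProductState.unique {A : Type u} [Ring A] [Algebra ℂ A] {φ : A →ₗ[ℂ] ℂ}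
    (hφ : φ 1 = 1) {ψ χ : FreeProd A →ₗ[ℂ] ℂ} (hψ : IsFreeProductState φ ψ)
    (hχ : IsFreeProductState φ χ) : ψ = χ := by
  apply LinearMap.ext_on (span_products A)
  rintro _ ⟨l, rfl⟩
  exact AreFree.unique hφ ψ χ (incl A) (incl A) hψ.map_one hχ.map_one hψ.map_incl hχ.map_incl
    hψ.areFree hχ.areFree l

/-! ### Existence of the free product state

`A` has a basis consisting of `1` and a basis of `ker φ`.  Let `V` be the space spanned by the
alternating words over that basis of `ker φ`, the letters carrying the number of a copy of `A`.  For
every `k` there is an isomorphism of `V` with the direct sum of copies of `A` indexed by the words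
which do not begin in the `k`-th copy, and so `A` acts on `V`, as the `k`-th copy.  The state is the
coefficient at the empty word of the image of the empty word. -/

section Existence

variable {A : Type u} [Ring A] [Algebra ℂ A]

theorem exists_centredBasis (φ : A →ₗ[ℂ] ℂ) (hφ : φ 1 = 1) :
    ∃ (S : Type u) (b : Module.Basis (Option S) ℂ A),
      b none = 1 ∧ ∀ a, b.repr a none = φ a := by
  let b₀ := Module.Basis.ofVectorSpace ℂ (LinearMap.ker φ)
  let e : (ℂ × LinearMap.ker φ) ≃ₗ[ℂ] A :=
    { toFun := fun x => x.1 • (1 : A) + x.2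
      map_add' := by intro x y; simp [add_smul]; abel
      map_smul' := by intro c x; simp [mul_smul]
      invFun := fun a => (φ a, ⟨a - φ a • 1, by simp [hφ]⟩)
      left_inv := by
        rintro ⟨c, x, hx⟩
        have hx' : φ x = 0 := hx
        simp [hφ, hx']
      right_inv := by intro a; simp }
  let b₁ := ((Module.Basis.singleton PUnit.{u + 1} ℂ).prod b₀).map e
  refine ⟨_, b₁.reindex ((Equiv.sumComm _ _).trans (Equiv.optionEquivSumPUnit _).symm),
    ?_, fun a => ?_⟩
  · simp [b₁, e]
  · rw [Module.Basis.repr_reindex_apply]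
    simp [b₁, e]

/-- The alternating words. -/
abbrev Word (S : Type u) : Type u := {l : List (ℕ × S) // l.IsChain (fun p q => p.1 ≠ q.1)}

/-- The words that do not begin in the `k`-th copy. -/
abbrev WordOff (S : Type u) (k : ℕ) : Type u := {w : Word S // ∀ p ∈ w.1.head?, p.1 ≠ k}

/-- Splitting off the first letter, if it belongs to the `k`-th copy. -/
def splitWord (S : Type u) (k : ℕ) : WordOff S k × Option S ≃ Word S where
  toFun x := match x with
    | (w, none) => w.1
    | (w, some s) => ⟨(k, s) :: w.1.1, List.isChain_cons.2 ⟨fun p hp => (w.2 p hp).symm, w.1.2⟩⟩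
  invFun w := match w with
    | ⟨[], h⟩ => (⟨⟨[], h⟩, by simp⟩, none)
    | ⟨p :: t, h⟩ =>
      if hp : p.1 = k then
        (⟨⟨t, (List.isChain_cons.1 h).2⟩, fun q hq =>
          hp ▸ ((List.isChain_cons.1 h).1 q hq).symm⟩, some p.2)
      else (⟨⟨p :: t, h⟩, by simpa using hp⟩, none)
  left_inv := by
    rintro ⟨⟨⟨l, hl⟩, hw⟩, _ | s⟩
    · cases l with
      | nil => rfl
      | cons p t =>
        have : p.1 ≠ k := hw p (by simp)
        simp [this]
    · simp
  right_inv := by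
    rintro ⟨_ | ⟨p, t⟩, h⟩
    · rfl
    · by_cases hp : p.1 = k
      · subst hp
        simp
      · simp [hp]

/-- The isomorphism of `V` with a direct sum of copies of `A`. -/
noncomputable def splitEquiv {S : Type u} (b : Module.Basis (Option S) ℂ A) (k : ℕ) :
    (WordOff S k →₀ A) ≃ₗ[ℂ] (Word S →₀ ℂ) :=
  (Finsupp.mapRange.linearEquiv b.repr).trans
    ((Finsupp.curryLinearEquiv ℂ).symm.trans (Finsupp.domLCongr (splitWord S k)))

/-- The action of `A` on `V` as the `k`-th copy. -/
noncomputable def wordRep {S : Type u} (b : Module.Basis (Option S) ℂ A) (k : ℕ) :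
    A →ₐ[ℂ] Module.End ℂ (Word S →₀ ℂ) :=
  ((splitEquiv b k).conjAlgEquiv ℂ).toAlgHom.comp (Algebra.lsmul ℂ ℂ (WordOff S k →₀ A))

theorem wordRep_apply {S : Type u} (b : Module.Basis (Option S) ℂ A) (hb : b none = 1) (k : ℕ)
    (a : A) (y : Word S →₀ ℂ) (hy : ∀ w s, y (splitWord S k (w, some s)) = 0)
    (w : WordOff S k) (o : Option S) :
    wordRep b k a y (splitWord S k (w, o)) = y w.1 * b.repr a o := by
  have split_apply : ∀ (Y : WordOff S k →₀ A) (o : Option S),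
      splitEquiv b k Y (splitWord S k (w, o)) = b.repr (Y w) o := by
    intro Y o
    simp [splitEquiv, Finsupp.domLCongr_apply]
  have hY : (splitEquiv b k).symm y w = y w.1 • (1 : A) := by
    apply b.repr.injective
    ext o
    rw [← split_apply, LinearEquiv.apply_symm_apply, ← hb]
    cases o with
    | none => simp [splitWord]
    | some s => simp [hy]
  have : wordRep b k a y = splitEquiv b k (a • (splitEquiv b k).symm y) := rfl
  rw [this, split_apply, Finsupp.smul_apply, hY]
  simp

theorem exists_freeProductState (φ : A →ₗ[ℂ] ℂ) (hφ : φ 1 = 1) :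
    ∃ ψ : FreeProd A →ₗ[ℂ] ℂ, IsFreeProductState φ ψ := by
  classical
  obtain ⟨S, b, hb, hbφ⟩ := exists_centredBasis φ hφ
  let e : Word S := ⟨[], List.IsChain.nil⟩
  let Ω : Word S →₀ ℂ := Finsupp.single e 1
  let R : FreeProd A →ₐ[ℂ] Module.End ℂ (Word S →₀ ℂ) :=
    LinearAlgebra.FreeProduct.lift ℂ (fun _ : ℕ => A) (fun {k} => wordRep b k)
  have hR : ∀ k a, R (incl A k a) = wordRep b k a := fun k a =>
    DFunLike.congr_fun (LinearAlgebra.FreeProduct.lift_comp_ι ℂ (fun _ : ℕ => A) (i := k)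
      (fun {k} => wordRep b k)) a
  let ψ : FreeProd A →ₗ[ℂ] ℂ :=
    (Finsupp.lapply e).comp ((LinearMap.applyₗ Ω).comp R.toLinearMap)
  have hψ : ∀ x, ψ x = R x Ω e := fun x => rfl
  have hΩ : ∀ k w s, Ω (splitWord S k (w, some s)) = 0 := by
    intro k w s
    apply Finsupp.single_eq_of_ne
    intro h
    have := congrArg Subtype.val h
    simp [splitWord, e] at this
  have hincl : ∀ k a, ψ (incl A k a) = φ a := by
    intro k a
    rw [hψ, hR]
    have := wordRep_apply b hb k a Ω (hΩ k) ⟨e, by simp [e]⟩ none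
    have h2 : splitWord S k (⟨e, by simp [e]⟩, none) = e := rfl
    rw [h2] at this
    rw [this, hbφ]
    simp [Ω]
  refine ⟨ψ, ?_, hincl, ?_⟩
  · rw [hψ, map_one]
    simp [Ω]
  · have main : ∀ l : List (ℕ × FreeProd A), l ≠ [] → l.IsChain (fun p q => p.1 ≠ q.1) →
        (∀ p ∈ l, p.2 ∈ (incl A p.1).range ∧ ψ p.2 = 0) →
        ∀ v : Word S, R (l.map Prod.snd).prod Ω v ≠ 0 →
          ∃ p ∈ v.1.head?, ∃ q ∈ l.head?, p.1 = q.1 := by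
      intro l
      induction l with
      | nil => intro h; exact absurd rfl h
      | cons x t ih =>
        intro _ hch hc v hv
        obtain ⟨⟨a, ha⟩, ha0⟩ := hc x (by simp)
        have haφ : φ a = 0 := by
          rw [← hincl x.1 a, ← ha0]
          exact congrArg ψ ha
        have hx : R x.2 = wordRep b x.1 a := by rw [← hR]; exact congrArg R ha.symm
        set y := R (t.map Prod.snd).prod Ω with hy
        have hy0 : ∀ w s, y (splitWord S x.1 (w, some s)) = 0 := by
          intro w s
          rcases eq_or_ne t [] with rfl | hne
          · simpa [hy] using hΩ x.1 w s
          · by_contra hcon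
            obtain ⟨p, hp, q, hq, hpq⟩ := ih hne (List.isChain_cons.1 hch).2
              (fun p hp => hc p (List.mem_cons_of_mem _ hp)) _ hcon
            have h1 := (List.isChain_cons.1 hch).1 q hq
            simp [splitWord] at hp
            rw [← hp] at hpq
            exact h1 hpq
        have hv' : wordRep b x.1 a y v ≠ 0 := by
          simpa [hx, hy] using hv
        obtain ⟨⟨w, o⟩, rfl⟩ := (splitWord S x.1).surjective v
        rw [wordRep_apply b hb x.1 a y hy0] at hv'
        cases o with
        | none => simp [hbφ, haφ] at hv'
        | some s => exact ⟨(x.1, s), by simp [splitWord], x, by simp, rfl⟩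
    intro l hne hch hc
    rw [hψ]
    by_contra hcon
    obtain ⟨p, hp, -⟩ := main l hne hch hc e hcon
    simp [e] at hp

end Existence

/-- The free product state: the unique unital functional on the free product that restricts to `φ`
on every copy of `A` and with respect to which the copies are free. -/
noncomputable def freeProductState {A : Type u} [Ring A] [Algebra ℂ A] (φ : A →ₗ[ℂ] ℂ)
    (hφ : φ 1 = 1) : FreeProd A →ₗ[ℂ] ℂ :=
  (exists_freeProductState φ hφ).choose

theorem freeProductState_spec {A : Type u} [Ring A] [Algebra ℂ A] (φ : A →ₗ[ℂ] ℂ)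
    (hφ : φ 1 = 1) : IsFreeProductState φ (freeProductState φ hφ) :=
  (exists_freeProductState φ hφ).choose_spec

theorem incl_injective (A : Type u) [Ring A] [Algebra ℂ A] (k : ℕ) :
    Function.Injective (incl A k) := by
  have h := LinearAlgebra.FreeProduct.lift_comp_ι ℂ (fun _ : ℕ => A) (i := k)
    (fun {_} => AlgHom.id ℂ A)
  exact Function.LeftInverse.injective (DFunLike.congr_fun h)

/-- The free exchangeability system: the free product of copies of `A`, with the free product
state. -/
noncomputable def freeSystem {A : Type u} [Ring A] [Algebra ℂ A] (φ : A →ₗ[ℂ] ℂ)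
    (hφ : φ 1 = 1) : ExchangeabilitySystem.{u, u} φ where
  space := FreeProd A
  state := freeProductState φ hφ
  state_one := (freeProductState_spec φ hφ).map_one
  copy := incl A
  copy_injective := incl_injective A
  state_copy := (freeProductState_spec φ hφ).map_incl
  interchangeable := by
    intro n X i σ
    have hs := freeProductState_spec φ hφ
    have hperm : AreFree (freeProductState φ hφ) fun k => (incl A (σ k)).range := by
      intro l hne hch hc
      have := hs.areFree (l.map fun p => (σ p.1, p.2)) (by simpa using hne)
        (by rw [List.isChain_map]; exact hch.imp fun _ _ h h' => h (σ.injective h'))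
        (by
          intro p hp
          obtain ⟨q, hq, rfl⟩ := List.mem_map.1 hp
          exact hc q hq)
      rw [List.map_map] at this
      exact this
    have := AreFree.unique hφ (freeProductState φ hφ) (freeProductState φ hφ) (incl A)
      (fun k => incl A (σ k)) hs.map_one hs.map_one hs.map_incl (fun k => hs.map_incl (σ k))
      hs.areFree hperm (List.ofFn fun j => (i j, X j))
    simpa [List.map_ofFn, Function.comp_def] using this

end FreeCumulants

/-!
The moments of the noncrossing partitions have a Möbius transform over the poset of noncrossing
partitions, `noncrossingCumulant`, and Speicher's formula asserts that this transform is the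
cumulant.  The heart of the matter is `IsFree.moment_eq_sum`: for free copies the partitioned moment
of *every* partition `π`, crossing or not, is the sum of the noncrossing cumulants below `π`.  Given
this, the function that is the noncrossing cumulant on noncrossing partitions and zero on crossing
ones sums to the moments over the lattice of all partitions, and therefore is the cumulant
(`IsFree.cumulant_eq`).

Both sides of `IsFree.moment_eq_sum` are multilinear in the arguments, and `eq_zero_of_alternating`
carries out the usual reduction to alternating products of centred elements without changing the
number of arguments: multiplying two neighbouring factors, or removing one, puts a unit in the
vacated place.  It remains to see that the sums of noncrossing cumulants behave like the moments.

* If the `i`-th argument is the unit, a moment does not change when `i` is isolated.  Isolating a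
  point is an interior operator on the noncrossing partitions, and so the cumulants are supported on
  the partitions with block `{i}` (`noncrossingCumulant_eq_zero_of_eq_one`).
* If `i < j` lie in the same block of `π` and only units stand between them, the moments of the
  partitions in which `i` and `j` are in one block do not change when the two factors are multiplied.
  On the partitions whose cumulants may be nonzero, joining the blocks of `i` and `j` preserves
  noncrossing and acts as a closure operator, and so the sum of the cumulants below `π` does not
  change either (`sum_noncrossingCumulant_merge`).
* If the arguments form an alternating product of centred elements for `π`, they do so for all
  finer partitions; all these moments vanish by freeness, and the cumulants with them.

The factorization of noncrossing moments (`IsFree.moment_eq_prod`) follows from the same reduction: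
in an alternating product with noncrossing kernel some factor is alone in its block.
-/

namespace FreeCumulants

open Finset

/-! ### Sums over down-sets of a finite poset -/

section Poset

variable {P : Type w} [PartialOrder P] [Fintype P]

open Classical in
theorem sum_moebius_right (x y : P) :
    ∑ z : P with x ≤ z ∧ z ≤ y, moebius x z = if x = y then 1 else 0 := by
  let : LocallyFiniteOrder P := Fintype.toLocallyFiniteOrder
  have h := IncidenceAlgebra.sum_Icc_mu_right (𝕜 := ℂ) x y
  have hs : (Icc x y : Finset P) = ({z : P | x ≤ z ∧ z ≤ y} : Finset P) := by
    ext z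
    simp
  rw [hs] at h
  rw [← h]
  unfold moebius
  congr!

open Classical in
theorem sum_moebius_left (x y : P) :
    ∑ z : P with x ≤ z ∧ z ≤ y, moebius z y = if x = y then 1 else 0 := by
  let : LocallyFiniteOrder P := Fintype.toLocallyFiniteOrder
  have h := IncidenceAlgebra.sum_Icc_mu_left (𝕜 := ℂ) x y
  have hs : (Icc x y : Finset P) = ({z : P | x ≤ z ∧ z ≤ y} : Finset P) := by
    ext z
    simp
  rw [hs] at h
  rw [← h]
  unfold moebius
  congr!

open Classical in
theorem sum_sum_le (F : P → P → ℂ) (y : P) :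
    ∑ z : P with z ≤ y, ∑ x : P with x ≤ z, F x z =
      ∑ x : P, ∑ z : P with x ≤ z ∧ z ≤ y, F x z := by
  refine Finset.sum_comm' fun z x => ?_
  simp [and_comm]

open Classical in
/-- Summing the Möbius transform of `g` over a principal down-set recovers `g`. -/
theorem sum_moebius_transform (g : P → ℂ) (y : P) :
    ∑ z : P with z ≤ y, ∑ x : P with x ≤ z, g x * moebius x z = g y := by
  rw [sum_sum_le (fun x z => g x * moebius x z)]
  simp [← mul_sum, sum_moebius_right]

open Classical in
/-- Möbius inversion from below, in a finite poset that need not have a least element. -/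
theorem moebius_transform_sum {f g : P → ℂ} (h : ∀ y, g y = ∑ x : P with x ≤ y, f x) (y : P) :
    ∑ x : P with x ≤ y, g x * moebius x y = f y := by
  simp only [h, sum_mul]
  rw [sum_sum_le (fun x z => f x * moebius z y)]
  simp [← mul_sum, sum_moebius_left]

open Classical in
/-- If the partial sums of `f` do not see the interior operator `int`, then `f` is supported on the
open elements. -/
theorem eq_zero_of_sum_interior (int : P → P) (hle : ∀ τ, int τ ≤ τ)
    (hmax : ∀ ρ τ, ρ ≤ τ → int ρ = ρ → ρ ≤ int τ) (f : P → ℂ)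
    (hf : ∀ τ, ∑ σ : P with σ ≤ τ, f σ = ∑ σ : P with σ ≤ int τ, f σ) (σ : P)
    (hσ : int σ ≠ σ) : f σ = 0 := by
  induction σ using WellFoundedLT.induction with
  | ind σ ih =>
  have hsub : ({ρ : P | ρ ≤ int σ} : Finset P) ⊆ ({ρ : P | ρ ≤ σ} : Finset P) := by
    intro ρ
    simpa using fun h => h.trans (hle σ)
  have h := Finset.sum_sdiff hsub (f := f)
  rw [hf σ, add_eq_right] at h
  rw [← h]
  symm
  apply Finset.sum_eq_single σ
  · intro ρ hρ hne
    simp only [mem_sdiff, mem_filter, mem_univ, true_and] at hρ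
    exact ih ρ (lt_of_le_of_ne hρ.1 hne) fun h => hρ.2 (hmax _ _ hρ.1 h)
  · intro hn
    exact absurd (by
      simp only [mem_sdiff, mem_filter, mem_univ, true_and]
      exact ⟨le_rfl, fun h => hσ (le_antisymm (hle σ) h)⟩) hn

open Classical in
/-- Suppose that every element of the support of `f` has a least upper bound in `Q`, its closure,
and that `f` has sum zero over the down-set of every element of `Q`.  Then `f` has sum zero over
every down-set that contains the closures of its elements. -/
theorem sum_eq_zero_of_closure (Q D : P → Prop) (f : P → ℂ)
    (hcl : ∀ σ, f σ ≠ 0 → ∃ τ, Q τ ∧ σ ≤ τ ∧ (∀ ρ, Q ρ → σ ≤ ρ → τ ≤ ρ) ∧ (D σ → D τ))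
    (hD : ∀ σ τ, σ ≤ τ → D τ → D σ)
    (hf : ∀ τ, Q τ → ∑ σ : P with σ ≤ τ, f σ = 0) :
    ∑ σ : P with D σ, f σ = 0 := by
  choose! cl hQ hle hmin hDcl using hcl
  -- `g τ` is the sum of `f` over the elements with closure `τ`
  let g : P → ℂ := fun τ => ∑ σ : P with f σ ≠ 0 ∧ cl σ = τ, f σ
  have hfib : ∀ C : P → Prop, (∀ σ, f σ ≠ 0 → (C σ ↔ C (cl σ))) →
      ∑ σ : P with C σ, f σ = ∑ τ : P with C τ, g τ := by
    intro C hC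
    rw [← Finset.sum_filter_ne_zero, Finset.filter_filter,
      ← Finset.sum_fiberwise_of_maps_to (t := ({τ : P | C τ} : Finset P)) (g := cl)]
    · refine Finset.sum_congr rfl fun τ hτ => Finset.sum_congr ?_ fun _ _ => rfl
      ext σ
      simp only [mem_filter, mem_univ, true_and] at hτ ⊢
      constructor
      · rintro ⟨⟨-, h⟩, h'⟩
        exact ⟨h, h'⟩
      · rintro ⟨h, rfl⟩
        exact ⟨⟨(hC σ h).2 hτ, h⟩, rfl⟩
    · intro σ hσ
      simp only [mem_filter, mem_univ, true_and] at hσ ⊢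
      exact (hC σ hσ.2).1 hσ.1
  have hg : ∀ τ, g τ = 0 := by
    intro τ
    induction τ using WellFoundedLT.induction with
    | ind τ ih =>
    by_cases hτ : ∃ σ, f σ ≠ 0 ∧ cl σ = τ
    · obtain ⟨σ₀, h₀, rfl⟩ := hτ
      have h := hfib (· ≤ cl σ₀) fun σ hσ =>
        ⟨fun h => hmin σ hσ _ (hQ _ h₀) h, fun h => (hle σ hσ).trans h⟩
      rw [hf _ (hQ _ h₀)] at h
      rw [h]
      symm
      apply Finset.sum_eq_single (cl σ₀)
      · intro ρ hρ hne
        simp only [mem_filter, mem_univ, true_and] at hρ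
        exact ih ρ (lt_of_le_of_ne hρ hne)
      · intro hn
        exact absurd (by simp) hn
    · apply Finset.sum_eq_zero
      intro σ hσ
      exact absurd ⟨σ, by simpa using hσ⟩ hτ
  rw [hfib D fun σ hσ => ⟨hDcl σ hσ, hD _ _ (hle σ hσ)⟩]
  exact Finset.sum_eq_zero fun τ _ => hg τ

end Poset

/-! ### Isolating a point and joining two blocks of a partition -/

section Partitions

variable {n : ℕ}

theorem SameBlock.refl (π : SetPartition n) (i : Fin n) : SameBlock π i i :=
  (sameBlock_iff_part_eq π i i).2 rfl

theorem SameBlock.symm {π : SetPartition n} {i j : Fin n} (h : SameBlock π i j) :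
    SameBlock π j i := by
  rw [sameBlock_iff_part_eq] at *
  exact Eq.symm h

theorem SameBlock.trans {π : SetPartition n} {i j k : Fin n} (h : SameBlock π i j)
    (h' : SameBlock π j k) : SameBlock π i k := by
  rw [sameBlock_iff_part_eq] at *
  exact Eq.trans h h'

theorem mem_part_iff_sameBlock (π : SetPartition n) (i j : Fin n) :
    j ∈ π.part i ↔ SameBlock π i j := by
  rw [sameBlock_iff_part_eq, π.mem_part_iff_part_eq_part (mem_univ j) (mem_univ i), eq_comm]

theorem le_iff_sameBlock {σ τ : SetPartition n} :
    σ ≤ τ ↔ ∀ i j, SameBlock σ i j → SameBlock τ i j := by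
  constructor
  · rintro h i j ⟨B, hB, hi, hj⟩
    obtain ⟨C, hC, hBC⟩ := h hB
    exact ⟨C, hC, hBC hi, hBC hj⟩
  · intro h B hB
    obtain ⟨i, hi⟩ := σ.nonempty_of_mem_parts hB
    refine ⟨τ.part i, τ.part_mem.2 (mem_univ i), fun j hj => ?_⟩
    exact (mem_part_iff_sameBlock τ i j).2 (h i j ⟨B, hB, hi, hj⟩)

open Classical in
/-- The partition into the classes of an equivalence relation. -/
noncomputable def ofRel (r : Fin n → Fin n → Prop) (h : Equivalence r) : SetPartition n :=
  Finpartition.ofSetoid ⟨r, h⟩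

theorem sameBlock_ofRel {r : Fin n → Fin n → Prop} (h : Equivalence r) (i j : Fin n) :
    SameBlock (ofRel r h) i j ↔ r i j := by
  classical
  rw [← mem_part_iff_sameBlock]
  exact Finpartition.mem_part_ofSetoid_iff_rel

/-- The partition obtained from `σ` by making `{i}` a block. -/
noncomputable def isolate (i : Fin n) (σ : SetPartition n) : SetPartition n :=
  ofRel (fun a b => SameBlock σ a b ∧ (a = i ↔ b = i))
    ⟨fun a => ⟨SameBlock.refl σ a, Iff.rfl⟩, fun h => ⟨h.1.symm, h.2.symm⟩,
      fun h h' => ⟨h.1.trans h'.1, h.2.trans h'.2⟩⟩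

theorem sameBlock_isolate (i : Fin n) (σ : SetPartition n) (a b : Fin n) :
    SameBlock (isolate i σ) a b ↔ SameBlock σ a b ∧ (a = i ↔ b = i) :=
  sameBlock_ofRel _ _ _

theorem isolate_le (i : Fin n) (σ : SetPartition n) : isolate i σ ≤ σ :=
  le_iff_sameBlock.2 fun _ _ h => ((sameBlock_isolate _ _ _ _).1 h).1

theorem not_hasCrossing_isolate (i : Fin n) {σ : SetPartition n} (h : ¬ HasCrossing σ) :
    ¬ HasCrossing (isolate i σ) := by
  rintro ⟨a, b, c, d, hab, hbc, hcd, hac, hbd, hn⟩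
  rw [sameBlock_isolate] at hac hbd hn
  refine h ⟨a, b, c, d, hab, hbc, hcd, hac.1, hbd.1, fun hs => hn ⟨hs, ?_⟩⟩
  constructor
  · intro ha
    exact absurd (ha.trans (hac.2.1 ha).symm) (hab.trans hbc).ne
  · intro hb
    exact absurd (hb.trans (hbd.2.1 hb).symm) (hbc.trans hcd).ne

/-- The partition obtained from `σ` by joining the blocks of `i` and `j`. -/
noncomputable def joinBlocks (i j : Fin n) (σ : SetPartition n) : SetPartition n :=
  ofRel (fun a b => SameBlock σ a b ∨
      (SameBlock σ a i ∨ SameBlock σ a j) ∧ (SameBlock σ b i ∨ SameBlock σ b j))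
    ⟨fun a => Or.inl (SameBlock.refl σ a), fun h => h.imp SameBlock.symm And.symm, by
      rintro a b c (h | ⟨h₁, h₂⟩) (h' | ⟨h₁', h₂'⟩)
      · exact Or.inl (h.trans h')
      · exact Or.inr ⟨h₁'.imp h.trans h.trans, h₂'⟩
      · exact Or.inr ⟨h₁, h₂.imp h'.symm.trans h'.symm.trans⟩
      · exact Or.inr ⟨h₁, h₂'⟩⟩

theorem sameBlock_joinBlocks (i j : Fin n) (σ : SetPartition n) (a b : Fin n) :
    SameBlock (joinBlocks i j σ) a b ↔ SameBlock σ a b ∨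
      (SameBlock σ a i ∨ SameBlock σ a j) ∧ (SameBlock σ b i ∨ SameBlock σ b j) :=
  sameBlock_ofRel _ _ _

theorem le_joinBlocks (i j : Fin n) (σ : SetPartition n) : σ ≤ joinBlocks i j σ :=
  le_iff_sameBlock.2 fun _ _ h => (sameBlock_joinBlocks _ _ _ _ _).2 (Or.inl h)

theorem sameBlock_joinBlocks_self (i j : Fin n) (σ : SetPartition n) :
    SameBlock (joinBlocks i j σ) i j :=
  (sameBlock_joinBlocks _ _ _ _ _).2
    (Or.inr ⟨Or.inl (SameBlock.refl σ i), Or.inr (SameBlock.refl σ j)⟩)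

theorem joinBlocks_le {i j : Fin n} {σ τ : SetPartition n} (h : σ ≤ τ) (hij : SameBlock τ i j) :
    joinBlocks i j σ ≤ τ := by
  rw [le_iff_sameBlock] at h ⊢
  have key : ∀ a, SameBlock σ a i ∨ SameBlock σ a j → SameBlock τ a i := by
    rintro a (ha | ha)
    · exact h _ _ ha
    · exact (h _ _ ha).trans hij.symm
  intro a b hab
  rcases (sameBlock_joinBlocks _ _ _ _ _).1 hab with hab | ⟨ha, hb⟩
  · exact h _ _ hab
  · exact (key a ha).trans (key b hb).symm

/-- Joining two blocks of a noncrossing partition creates no crossing if the points between `i` and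
`j` form blocks of their own. -/
theorem not_hasCrossing_joinBlocks {i j : Fin n} (hij : i < j) {σ : SetPartition n}
    (h : ¬ HasCrossing σ) (hs : ∀ k, i < k → k < j → ∀ a, SameBlock σ k a → a = k) :
    ¬ HasCrossing (joinBlocks i j σ) := by
  have hnc : ∀ a b c d, a < b → b < c → c < d → SameBlock σ a c → SameBlock σ b d →
      SameBlock σ a b := by
    intro a b c d h₁ h₂ h₃ h₄ h₅
    by_contra h₆
    exact h ⟨a, b, c, d, h₁, h₂, h₃, h₄, h₅, h₆⟩
  have hr := SameBlock.refl σ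
  have hsy : ∀ a b, SameBlock σ a b → SameBlock σ b a := fun _ _ => SameBlock.symm
  have htr : ∀ a b c, SameBlock σ a b → SameBlock σ b c → SameBlock σ a c :=
    fun _ _ _ => SameBlock.trans
  rintro ⟨a, b, c, d, hab, hbc, hcd, hac, hbd, hn⟩
  simp only [sameBlock_joinBlocks] at hac hbd hn
  -- a crossing of the joined block with a block of `σ` has no point of that block between `i` and
  -- `j`, and hence is already a crossing of that block with the block of `i` or with that of `j`
  generalize SameBlock σ = r at *
  grind

end Partitions

/-! ### Ordered products with trivial factors -/

section OrderedProducts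

variable {n : ℕ} {M : Type v} [Monoid M]

/-- If the factors between `i` and `j` are trivial, the `j`-th factor may be moved to position
`i`. -/
theorem prod_ofFn_merge (f : Fin n → M) {i j : Fin n} (hij : i < j)
    (h : ∀ k, i < k → k < j → f k = 1) :
    (List.ofFn f).prod =
      (List.ofFn (Function.update (Function.update f i (f i * f j)) j 1)).prod := by
  set f' := Function.update (Function.update f i (f i * f j)) j 1 with hf'
  -- the partial products differ by the factor `f j` between `i` and `j`, and agree elsewhere
  have key : ∀ m, m ≤ n →
      ((m ≤ i ∨ (j : ℕ) < m) → ((List.ofFn f').take m).prod = ((List.ofFn f).take m).prod) ∧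
      (((i : ℕ) < m ∧ m ≤ j) →
        ((List.ofFn f').take m).prod = ((List.ofFn f).take m).prod * f j) := by
    intro m
    induction m with
    | zero => simp
    | succ m ih =>
      intro hm
      obtain ⟨ih₁, ih₂⟩ := ih (by omega)
      rw [List.prod_take_succ _ _ (by simpa using hm), List.prod_take_succ _ _ (by simpa using hm)]
      simp only [List.getElem_ofFn]
      have hij' : (i : ℕ) < j := hij
      have hne : i ≠ j := hij.ne
      rcases lt_trichotomy m i with h₁ | h₁ | h₁
      · have e : f' ⟨m, hm⟩ = f ⟨m, hm⟩ := by
          rw [hf', Function.update_of_ne, Function.update_of_ne] <;>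
            (rw [Ne, Fin.ext_iff]; simp; omega)
        rw [e, ih₁ (by omega)]
        exact ⟨fun _ => rfl, fun _ => by omega⟩
      · have e : (⟨m, hm⟩ : Fin n) = i := Fin.ext h₁
        rw [e, ih₁ (by omega), hf', Function.update_of_ne hne, Function.update_self]
        exact ⟨fun _ => by omega, fun _ => by rw [mul_assoc]⟩
      · rcases lt_trichotomy m j with h₂ | h₂ | h₂
        · have e : f' ⟨m, hm⟩ = f ⟨m, hm⟩ := by
            rw [hf', Function.update_of_ne, Function.update_of_ne] <;>
              (rw [Ne, Fin.ext_iff]; simp; omega)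
          rw [e, h ⟨m, hm⟩ h₁ h₂, ih₂ (by omega)]
          exact ⟨fun _ => by omega, fun _ => by simp⟩
        · have e : (⟨m, hm⟩ : Fin n) = j := Fin.ext h₂
          rw [e, ih₂ (by omega), hf', Function.update_self]
          exact ⟨fun _ => by simp, fun _ => by omega⟩
        · have e : f' ⟨m, hm⟩ = f ⟨m, hm⟩ := by
            rw [hf', Function.update_of_ne, Function.update_of_ne] <;>
              (rw [Ne, Fin.ext_iff]; simp; omega)
          rw [e, ih₁ (by omega)]
          exact ⟨fun _ => rfl, fun _ => by omega⟩
  have := (key n le_rfl).1 (Or.inr j.2)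
  rw [List.take_of_length_le (by simp), List.take_of_length_le (by simp)] at this
  exact this.symm

theorem sort_eq_filter_finRange (S : Finset (Fin n)) :
    S.sort = (List.finRange n).filter (· ∈ S) := by
  have h : ((List.finRange n).filter (· ∈ S)).toFinset = S := by
    ext i
    simp
  nth_rewrite 1 [← h]
  rw [List.toFinset_sort]
  · exact (List.pairwise_le_finRange n).filter _
  · exact (List.nodup_finRange n).filter _

theorem prod_map_filter_of_eq_one {ι : Type w} (p : ι → Prop) [DecidablePred p] (f : ι → M)
    (h : ∀ k, ¬ p k → f k = 1) (l : List ι) :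
    ((l.filter p).map f).prod = (l.map f).prod := by
  induction l with
  | nil => rfl
  | cons a t ih =>
    by_cases ha : p a
    · simp [ha, ih]
    · simp [ha, ih, h a ha]

theorem prod_ofFn_eq_prod_sort (f : Fin n → M) (S : Finset (Fin n)) (h : ∀ k ∉ S, f k = 1) :
    (List.ofFn f).prod = (S.sort.map f).prod := by
  rw [sort_eq_filter_finRange, prod_map_filter_of_eq_one (· ∈ S) f h, List.ofFn_eq_map]

end OrderedProducts

theorem orderedProd_eq {A : Type u} [Ring A] {n : ℕ} (B : Finset (Fin n)) (X : Fin n → A) :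
    orderedProd B X = (List.ofFn fun k => if k ∈ B then X k else 1).prod := by
  rw [prod_ofFn_eq_prod_sort _ B (fun k hk => if_neg hk)]
  unfold orderedProd
  congr 1
  apply List.map_congr_left
  intro k hk
  rw [if_pos ((B.mem_sort _).1 hk)]

/-! ### Reduction to alternating products of centred elements -/

/-- Neighbours in `S` lie in different blocks of `π`. -/
def IsAlternating {n : ℕ} (π : SetPartition n) (S : Finset (Fin n)) : Prop :=
  ∀ i ∈ S, ∀ j ∈ S, i < j → (∀ k ∈ S, i < k → ¬ k < j) → ¬ SameBlock π i j

theorem IsAlternating.mono {n : ℕ} {π σ : SetPartition n} {S : Finset (Fin n)}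
    (h : IsAlternating π S) (hσ : σ ≤ π) : IsAlternating σ S :=
  fun i hi j hj hij hk hs => h i hi j hj hij hk (le_iff_sameBlock.1 hσ i j hs)

theorem IsAlternating.isChain_sort {n : ℕ} {π : SetPartition n} {S : Finset (Fin n)}
    (h : IsAlternating π S) : S.sort.IsChain (fun i j => ¬ SameBlock π i j) := by
  rw [List.isChain_iff_getElem]
  intro m hm
  have hs : S.sort.SortedLT := S.sortedLT_sort
  have hmono := hs.strictMono_get
  refine h _ ((S.mem_sort (· ≤ ·)).1 (List.getElem_mem _)) _
    ((S.mem_sort (· ≤ ·)).1 (List.getElem_mem _)) ?_ ?_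
  · exact hmono (a := ⟨m, by omega⟩) (b := ⟨m + 1, hm⟩) (Fin.mk_lt_mk.2 (Nat.lt_succ_self m))
  · intro k hk h₁ h₂
    obtain ⟨⟨p, hp⟩, rfl⟩ := List.mem_iff_get.1 ((S.mem_sort (· ≤ ·)).2 hk)
    have h₁' := hmono.lt_iff_lt.1 (show S.sort.get ⟨m, by omega⟩ < _ from h₁)
    have h₂' := hmono.lt_iff_lt.1 (show _ < S.sort.get ⟨m + 1, hm⟩ from h₂)
    simp only [Fin.mk_lt_mk] at h₁' h₂'
    omega

section Reduction

variable {A : Type u} [Ring A] [Algebra ℂ A] {φ : A →ₗ[ℂ] ℂ} {n : ℕ}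

/-- `Δ` may be expanded along the decomposition of any argument into its centred part and a multiple
of the unit; every map that is linear in each argument has this property. -/
def IsCentrable (φ : A →ₗ[ℂ] ℂ) (Δ : (Fin n → A) → ℂ) : Prop :=
  ∀ X i, Δ X = Δ (Function.update X i (X i - φ (X i) • 1)) +
    φ (X i) * Δ (Function.update X i 1)

theorem IsCentrable.sub {Δ Δ' : (Fin n → A) → ℂ} (h : IsCentrable φ Δ) (h' : IsCentrable φ Δ') :
    IsCentrable φ fun X => Δ X - Δ' X := by
  intro X i
  simp only
  rw [h X i, h' X i]
  ring

theorem IsCentrable.mul_const {Δ : (Fin n → A) → ℂ} (h : IsCentrable φ Δ) (c : ℂ) :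
    IsCentrable φ fun X => Δ X * c := by
  intro X i
  simp only
  rw [h X i]
  ring

theorem IsCentrable.sum {ι : Type w} (s : Finset ι) {Δ : ι → (Fin n → A) → ℂ}
    (h : ∀ σ, IsCentrable φ (Δ σ)) : IsCentrable φ fun X => ∑ σ ∈ s, Δ σ X := by
  intro X i
  simp only
  rw [Finset.mul_sum, ← Finset.sum_add_distrib]
  exact Finset.sum_congr rfl fun σ _ => h σ X i

theorem isCentrable_multilinear (f : MultilinearMap ℂ (fun _ : Fin n => A) ℂ) :
    IsCentrable φ f := by
  intro X i
  rw [f.map_update_sub, f.map_update_smul, Function.update_eq_self]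
  simp

/-- To show that a functional vanishes identically it suffices to move factors of equal colour
together across units, and to treat alternating products of centred elements.  The induction is on
the set of positions that are not known to hold the unit. -/
theorem eq_zero_of_alternating (hφ : φ 1 = 1) (π : SetPartition n) (Δ : (Fin n → A) → ℂ)
    (hcent : IsCentrable φ Δ)
    (hmerge : ∀ X i j, i < j → SameBlock π i j → (∀ k, i < k → k < j → X k = 1) →
      Δ X = Δ (Function.update (Function.update X i (X i * X j)) j 1))
    (hbase : ∀ S X, (∀ k ∉ S, X k = 1) → (∀ k ∈ S, φ (X k) = 0) → IsAlternating π S → Δ X = 0)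
    (X : Fin n → A) : Δ X = 0 := by
  classical
  suffices H : ∀ (S : Finset (Fin n)) (X : Fin n → A), (∀ k ∉ S, X k = 1) → Δ X = 0 from
    H univ X fun k hk => absurd (mem_univ k) hk
  clear X
  intro S
  induction S using Finset.strongInduction with
  | H S ih =>
  by_cases hS : IsAlternating π S
  · -- centre the arguments in the positions of `T`
    have main : ∀ (T : Finset (Fin n)) (X : Fin n → A), (∀ k ∉ S, X k = 1) →
        (∀ k ∈ S, k ∉ T → φ (X k) = 0) → Δ X = 0 := by
      intro T
      induction T using Finset.induction_on with
      | empty => exact fun X h₁ h₂ => hbase S X h₁ (fun k hk => h₂ k hk (notMem_empty k)) hS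
      | insert i T _ ihT =>
        intro X h₁ h₂
        by_cases hi : i ∈ S
        · rw [hcent X i, ihT (Function.update X i (X i - φ (X i) • 1)),
            ih (S.erase i) (erase_ssubset hi) (Function.update X i 1)]
          · simp
          · intro k hk
            rcases eq_or_ne k i with rfl | hki
            · simp
            · rw [Function.update_of_ne hki]
              exact h₁ k fun h => hk (mem_erase.2 ⟨hki, h⟩)
          · intro k hk
            rw [Function.update_of_ne (ne_of_mem_of_not_mem hi hk).symm]
            exact h₁ k hk
          · intro k hk hkT
            rcases eq_or_ne k i with rfl | hki
            · simp [hφ]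
            · rw [Function.update_of_ne hki]
              exact h₂ k hk (by simp [hki, hkT])
        · refine ihT X h₁ fun k hk hkT => h₂ k hk ?_
          rw [mem_insert, not_or]
          exact ⟨fun h => hi (h ▸ hk), hkT⟩
    exact fun X h => main univ X h fun k _ hk => absurd (mem_univ k) hk
  · intro X hX
    unfold IsAlternating at hS
    push Not at hS
    obtain ⟨i, hi, j, hj, hij, hbet, hs⟩ := hS
    rw [hmerge X i j hij hs fun k h₁ h₂ => hX k fun hk => absurd h₂ (not_lt.2 (hbet k hk h₁))]
    apply ih (S.erase j) (erase_ssubset hj)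
    intro k hk
    rcases eq_or_ne k j with rfl | hkj
    · simp
    · have hkS : k ∉ S := fun h => hk (mem_erase.2 ⟨hkj, h⟩)
      rw [Function.update_of_ne hkj, Function.update_of_ne (ne_of_mem_of_not_mem hi hkS).symm]
      exact hX k hkS

end Reduction

/-! ### Partitioned moments -/

namespace ExchangeabilitySystem

variable {A : Type u} [Ring A] [Algebra ℂ A] {φ : A →ₗ[ℂ] ℂ} {n : ℕ}
  (E : ExchangeabilitySystem.{u, v} φ)

theorem isCentrable_moment (π : SetPartition n) : IsCentrable φ (E.moment π) :=
  isCentrable_multilinear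
    (E.state.compMultilinearMap ((MultilinearMap.mkPiAlgebraFin ℂ n E.space).compLinearMap
      fun j => (E.copy (blockIndex π j)).toLinearMap))

theorem moment_eq_one (π : SetPartition n) (X : Fin n → A) (h : ∀ k, X k = 1) :
    E.moment π X = 1 := by
  have : X = fun _ => 1 := funext h
  subst this
  simp [moment, List.ofFn_const, E.state_one]

/-- The colour of a unit does not matter. -/
theorem moment_isolate (π : SetPartition n) (X : Fin n → A) (i : Fin n) (hi : X i = 1) :
    E.moment (isolate i π) X = E.moment π X := by
  -- `n` is not the index of a block, so that it may serve as the colour of `i`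
  have hlt : ∀ k, blockIndex π k ≠ n := fun k => (Fin.is_lt _).ne
  rw [← E.moment_eq_of_ker (isolate i π) X (Function.update (blockIndex π) i n)]
  · unfold moment
    congr 3
    funext k
    rcases eq_or_ne k i with rfl | hk
    · simp [hi]
    · rw [Function.update_of_ne hk]
  · intro a b
    rw [sameBlock_isolate, ← blockIndex_eq_iff]
    by_cases ha : a = i <;> by_cases hb : b = i
    · simp [ha, hb]
    · simp [ha, hb, (hlt b).symm]
    · simp [ha, hb, hlt a]
    · simp [ha, hb]

theorem moment_merge (π : SetPartition n) (X : Fin n → A) {i j : Fin n} (hij : i < j)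
    (hs : SameBlock π i j) (h : ∀ k, i < k → k < j → X k = 1) :
    E.moment π X = E.moment π (Function.update (Function.update X i (X i * X j)) j 1) := by
  unfold moment
  rw [prod_ofFn_merge _ hij fun k h₁ h₂ => by rw [h k h₁ h₂, map_one]]
  congr 3
  funext k
  rcases eq_or_ne k j with rfl | hkj
  · simp
  · rw [Function.update_of_ne hkj, Function.update_of_ne hkj]
    rcases eq_or_ne k i with rfl | hki
    · simp [(blockIndex_eq_iff π k j).2 hs]
    · rw [Function.update_of_ne hki, Function.update_of_ne hki]

/-- Freeness, for partitioned moments. -/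
theorem IsFree.moment_eq_zero {E : ExchangeabilitySystem.{u, v} φ} (hE : E.IsFree)
    (π : SetPartition n) (S : Finset (Fin n)) (hS : S.Nonempty) (X : Fin n → A)
    (h₁ : ∀ k ∉ S, X k = 1) (h₀ : ∀ k ∈ S, φ (X k) = 0) (halt : IsAlternating π S) :
    E.moment π X = 0 := by
  have h := hE (S.sort.map fun k => (blockIndex π k, E.copy (blockIndex π k) (X k)))
    (by simpa [← List.length_eq_zero_iff] using hS.ne_empty)
    (by
      rw [List.isChain_map]
      exact halt.isChain_sort.imp fun i j hn he => hn ((blockIndex_eq_iff π i j).1 he))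
    (by
      intro p hp
      obtain ⟨k, hk, rfl⟩ := List.mem_map.1 hp
      exact ⟨⟨X k, rfl⟩, by rw [E.state_copy]; exact h₀ k ((S.mem_sort _).1 hk)⟩)
  rw [List.map_map] at h
  unfold moment
  rw [prod_ofFn_eq_prod_sort _ S fun k hk => by rw [h₁ k hk, map_one]]
  exact h

theorem moment_of_single_block (π : SetPartition n) (hπ : ∀ i j, SameBlock π i j)
    (X : Fin n → A) : E.moment π X = φ (List.ofFn X).prod := by
  rw [← E.moment_eq_of_ker π X (fun _ => 0) fun i j => by simp [hπ i j],
    ← E.state_copy 0, map_list_prod (E.copy 0), List.map_ofFn]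
  rfl

end ExchangeabilitySystem

/-! ### Factorization of the noncrossing moments -/

/-- An innermost pair of points of `S` in a common block would enclose a point of `S` by
alternation, which together with a companion in its own block would form a crossing or a pair
further inside. -/
theorem IsAlternating.exists_isolated {n : ℕ} {σ : SetPartition n} {S : Finset (Fin n)}
    (halt : IsAlternating σ S) (hσ : ¬ HasCrossing σ) (hS : S.Nonempty) :
    ∃ i ∈ S, ∀ k ∈ S, SameBlock σ i k → k = i := by
  by_contra! hcon
  have main : ∀ d, ∀ i ∈ S, ∀ j ∈ S, i < j → SameBlock σ i j → (j : ℕ) - i ≠ d := by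
    intro d
    induction d using Nat.strong_induction_on with
    | _ d ih =>
    intro i hi j hj hij hs hd
    have hb : ∃ k ∈ S, i < k ∧ k < j := by
      by_contra! h
      exact halt i hi j hj hij (fun k hk h₁ => not_lt.2 (h k hk h₁)) hs
    obtain ⟨k, hk, hik, hkj⟩ := hb
    obtain ⟨m, hm, hkm, hne⟩ := hcon k hk
    have hij' : (i : ℕ) < j := hij
    have hik' : (i : ℕ) < k := hik
    have hkj' : (k : ℕ) < j := hkj
    by_cases h : SameBlock σ i k
    · exact ih _ (by omega) i hi k hk hik h rfl
    have him : i < m := by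
      rcases lt_trichotomy m i with h₁ | h₁ | h₁
      · exact absurd ⟨m, i, k, j, h₁, hik, hkj, hkm.symm, hs, fun h' =>
          h (h'.symm.trans hkm.symm)⟩ hσ
      · exact absurd (h₁ ▸ hkm).symm h
      · exact h₁
    have hmj : m < j := by
      rcases lt_trichotomy m j with h₁ | h₁ | h₁
      · exact h₁
      · exact absurd (hs.trans (h₁ ▸ hkm).symm) h
      · exact absurd ⟨i, k, j, m, hik, hkj, h₁, hs, hkm, h⟩ hσ
    have him' : (i : ℕ) < m := him
    have hmj' : (m : ℕ) < j := hmj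
    rcases lt_or_gt_of_ne hne with h₁ | h₁
    · exact ih _ (by omega) m hm k hk h₁ hkm.symm rfl
    · exact ih _ (by omega) k hk m hm h₁ hkm rfl
  obtain ⟨i, hi⟩ := hS
  obtain ⟨k, hk, hs, hne⟩ := hcon i hi
  rcases lt_or_gt_of_ne hne with h | h
  · exact main _ k hk i hi h hs.symm rfl
  · exact main _ i hi k hk h hs rfl

section Factorization

variable {A : Type u} [Ring A] {n : ℕ}

theorem orderedProd_update_of_notMem {B : Finset (Fin n)} (X : Fin n → A) {i : Fin n}
    (hi : i ∉ B) (a : A) : orderedProd B (Function.update X i a) = orderedProd B X := by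
  unfold orderedProd
  congr 1
  apply List.map_congr_left
  intro k hk
  exact Function.update_of_ne (ne_of_mem_of_not_mem ((B.mem_sort _).1 hk) hi) _ _

theorem orderedProd_update_of_mem {B : Finset (Fin n)} (X : Fin n → A) {i : Fin n}
    (hi : i ∈ B) (a : A) : orderedProd B (Function.update X i a) =
      (List.ofFn (Function.update (fun k => if k ∈ B then X k else 1) i a)).prod := by
  rw [orderedProd_eq]
  congr 2
  funext k
  rcases eq_or_ne k i with rfl | hk
  · simp [hi]
  · simp [hk]

theorem part_eq_of_mem {σ : SetPartition n} {B : Finset (Fin n)} (hB : B ∈ σ.parts) {i : Fin n}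
    (hi : i ∈ B) : B = σ.part i :=
  σ.eq_of_mem_parts hB (σ.part_mem.2 (mem_univ i)) hi (σ.mem_part (mem_univ i))

theorem orderedProd_merge {σ : SetPartition n} {B : Finset (Fin n)} (hB : B ∈ σ.parts)
    (X : Fin n → A) {i j : Fin n} (hij : i < j) (hs : SameBlock σ i j)
    (h : ∀ k, i < k → k < j → X k = 1) :
    orderedProd B X =
      orderedProd B (Function.update (Function.update X i (X i * X j)) j 1) := by
  have hiff : i ∈ B ↔ j ∈ B := by
    rw [sameBlock_iff_part_eq] at hs
    constructor
    · intro hi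
      rw [part_eq_of_mem hB hi, hs]
      exact σ.mem_part (mem_univ j)
    · intro hj
      rw [part_eq_of_mem hB hj, ← hs]
      exact σ.mem_part (mem_univ i)
  by_cases hi : i ∈ B
  · have hj := hiff.1 hi
    rw [orderedProd_eq, orderedProd_eq, prod_ofFn_merge _ hij fun k h₁ h₂ => by simp [h k h₁ h₂]]
    congr 2
    funext k
    rcases eq_or_ne k j with rfl | hkj
    · simp
    · rcases eq_or_ne k i with rfl | hki
      · simp [hkj, hi, hj]
      · simp [hkj, hki]
  · rw [orderedProd_update_of_notMem _ (fun hj => hi (hiff.2 hj)),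
      orderedProd_update_of_notMem _ hi]

variable [Algebra ℂ A] {φ : A →ₗ[ℂ] ℂ}

theorem isCentrable_prod_orderedProd (σ : SetPartition n) :
    IsCentrable φ fun X => ∏ B ∈ σ.parts, φ (orderedProd B X) := by
  intro X i
  have hmem : i ∈ σ.part i := σ.mem_part (mem_univ i)
  have hrest : ∀ a, ∏ B ∈ σ.parts.erase (σ.part i), φ (orderedProd B (Function.update X i a)) =
      ∏ B ∈ σ.parts.erase (σ.part i), φ (orderedProd B X) := by
    intro a
    refine Finset.prod_congr rfl fun B hB => ?_
    rw [mem_erase] at hB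
    rw [orderedProd_update_of_notMem _ fun hi => hB.1 (part_eq_of_mem hB.2 hi)]
  have hpart := isCentrable_multilinear (φ := φ)
    (φ.compMultilinearMap (MultilinearMap.mkPiAlgebraFin ℂ n A))
    (fun k => if k ∈ σ.part i then X k else 1) i
  simp only [LinearMap.compMultilinearMap_apply, MultilinearMap.mkPiAlgebraFin_apply,
    ← orderedProd_update_of_mem X hmem, ← orderedProd_eq, if_pos hmem] at hpart
  simp only [← Finset.mul_prod_erase σ.parts _ (σ.part_mem.2 (mem_univ i)), hrest]
  rw [hpart]
  ring

theorem ExchangeabilitySystem.IsFree.moment_eq_prod {E : ExchangeabilitySystem.{u, v} φ}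
    (hE : E.IsFree) (hφ : φ 1 = 1) {σ : SetPartition n} (hσ : ¬ HasCrossing σ) (X : Fin n → A) :
    E.moment σ X = ∏ B ∈ σ.parts, φ (orderedProd B X) := by
  refine sub_eq_zero.1 (eq_zero_of_alternating hφ σ
    (fun X => E.moment σ X - ∏ B ∈ σ.parts, φ (orderedProd B X))
    ((E.isCentrable_moment σ).sub (isCentrable_prod_orderedProd σ)) ?_ ?_ X)
  · intro X i j hij hs h
    rw [E.moment_merge σ X hij hs h,
      Finset.prod_congr rfl fun B hB => by rw [orderedProd_merge hB X hij hs h]]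
  · intro S X h₁ h₀ halt
    rcases S.eq_empty_or_nonempty with rfl | hS
    · have h : ∀ k, X k = 1 := fun k => h₁ k (notMem_empty k)
      rw [E.moment_eq_one σ X h, Finset.prod_eq_one, sub_self]
      intro B _
      rw [orderedProd_eq]
      simp [h, hφ]
    · obtain ⟨i, hi, hiso⟩ := halt.exists_isolated hσ hS
      rw [hE.moment_eq_zero σ S hS X h₁ h₀ halt,
        Finset.prod_eq_zero (σ.part_mem.2 (mem_univ i)), sub_self]
      rw [orderedProd_eq, prod_ofFn_eq_prod_sort _ {i}]
      · simp [h₀ i hi]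
      · intro k hk
        rw [mem_singleton] at hk
        by_cases hki : k ∈ σ.part i
        · rw [if_pos hki]
          exact h₁ k fun hkS => hk (hiso k hkS ((mem_part_iff_sameBlock σ i k).1 hki))
        · rw [if_neg hki]

end Factorization

/-! ### Noncrossing cumulants -/

section NoncrossingCumulants

variable {A : Type u} [Ring A] [Algebra ℂ A] {φ : A →ₗ[ℂ] ℂ} {n : ℕ}

open Classical in
theorem noncrossingBelow_val (π : NoncrossingPartition n) :
    noncrossingBelow π.1 = ({σ : NoncrossingPartition n | σ ≤ π} : Finset _) := by
  ext σ
  simp [noncrossingBelow]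

theorem mem_noncrossingBelow {π : SetPartition n} {σ : NoncrossingPartition n} :
    σ ∈ noncrossingBelow π ↔ σ.1 ≤ π := by
  simp [noncrossingBelow]

namespace ExchangeabilitySystem

variable (E : ExchangeabilitySystem.{u, v} φ)

/-- The Möbius transform of the partitioned moments over the poset of noncrossing partitions, that
is, the right-hand side of Speicher's formula. -/
noncomputable def noncrossingCumulant (π : NoncrossingPartition n) (X : Fin n → A) : ℂ :=
  ∑ σ ∈ noncrossingBelow π.1, E.moment σ.1 X * moebius σ π

theorem sum_noncrossingCumulant (π : NoncrossingPartition n) (X : Fin n → A) :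
    ∑ σ ∈ noncrossingBelow π.1, E.noncrossingCumulant σ X = E.moment π.1 X := by
  classical
  simp only [noncrossingCumulant, noncrossingBelow_val]
  exact sum_moebius_transform (fun σ : NoncrossingPartition n => E.moment σ.1 X) π

/-- A noncrossing cumulant with a unit among its arguments vanishes, unless the position of the unit
is a block of its own. -/
theorem noncrossingCumulant_eq_zero_of_eq_one (X : Fin n → A) (i : Fin n) (hi : X i = 1)
    (σ : NoncrossingPartition n) {a : Fin n} (ha : SameBlock σ.1 i a) (hne : a ≠ i) :
    E.noncrossingCumulant σ X = 0 := by
  classical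
  refine eq_zero_of_sum_interior
    (fun τ : NoncrossingPartition n => ⟨isolate i τ.1, not_hasCrossing_isolate i τ.2⟩)
    (fun τ => isolate_le i τ.1) ?_ (fun σ => E.noncrossingCumulant σ X) ?_ σ ?_
  · intro ρ τ hρτ hρ
    have hρ' : isolate i ρ.1 = ρ.1 := congrArg Subtype.val hρ
    change ρ.1 ≤ isolate i τ.1
    rw [le_iff_sameBlock]
    intro a b hab
    rw [sameBlock_isolate]
    refine ⟨le_iff_sameBlock.1 hρτ a b hab, ?_⟩
    rw [← hρ', sameBlock_isolate] at hab
    exact hab.2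
  · intro τ
    rw [← noncrossingBelow_val, ← noncrossingBelow_val, sum_noncrossingCumulant,
      sum_noncrossingCumulant]
    exact (E.moment_isolate τ.1 X i hi).symm
  · intro h
    have h' : isolate i σ.1 = σ.1 := congrArg Subtype.val h
    rw [← h', sameBlock_isolate] at ha
    exact hne (ha.2.1 rfl)

theorem isCentrable_noncrossingCumulant (σ : NoncrossingPartition n) :
    IsCentrable φ (E.noncrossingCumulant σ) :=
  IsCentrable.sum _ fun τ => (E.isCentrable_moment τ.1).mul_const _

/-- The sum of the noncrossing cumulants below an arbitrary partition is unchanged when neighbouring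
factors of the same colour are multiplied. -/
theorem sum_noncrossingCumulant_merge (π : SetPartition n) (X : Fin n → A) {i j : Fin n}
    (hij : i < j) (hs : SameBlock π i j) (h : ∀ k, i < k → k < j → X k = 1) :
    ∑ σ ∈ noncrossingBelow π, E.noncrossingCumulant σ X =
      ∑ σ ∈ noncrossingBelow π, E.noncrossingCumulant σ
        (Function.update (Function.update X i (X i * X j)) j 1) := by
  classical
  set X' := Function.update (Function.update X i (X i * X j)) j 1 with hX'
  have h' : ∀ k, i < k → k < j → X' k = 1 := by
    intro k h₁ h₂
    rw [hX', Function.update_of_ne h₂.ne, Function.update_of_ne h₁.ne']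
    exact h k h₁ h₂
  rw [← sub_eq_zero, ← Finset.sum_sub_distrib]
  refine sum_eq_zero_of_closure (fun τ : NoncrossingPartition n => SameBlock τ.1 i j)
    (fun σ => σ.1 ≤ π) (fun σ => E.noncrossingCumulant σ X - E.noncrossingCumulant σ X') ?_ ?_ ?_
  · intro σ hσ
    have hiso : ∀ k, i < k → k < j → ∀ a, SameBlock σ.1 k a → a = k := by
      intro k h₁ h₂ a hka
      by_contra hne
      apply hσ
      rw [E.noncrossingCumulant_eq_zero_of_eq_one X k (h k h₁ h₂) σ hka hne,
        E.noncrossingCumulant_eq_zero_of_eq_one X' k (h' k h₁ h₂) σ hka hne, sub_zero]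
    exact ⟨⟨joinBlocks i j σ.1, not_hasCrossing_joinBlocks hij σ.2 hiso⟩,
      sameBlock_joinBlocks_self i j σ.1, le_joinBlocks i j σ.1,
      fun ρ hρ hle => joinBlocks_le (τ := ρ.1) hle hρ, fun hle => joinBlocks_le hle hs⟩
  · exact fun σ τ hστ hτ => le_trans (show σ.1 ≤ τ.1 from hστ) hτ
  · intro τ hτ
    rw [Finset.sum_sub_distrib, ← noncrossingBelow_val, sum_noncrossingCumulant,
      sum_noncrossingCumulant, E.moment_merge τ.1 X hij hτ h, sub_self]

/-- Below an arbitrary partition the noncrossing cumulants of units add up to `1`: only the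
partition into singletons contributes. -/
theorem sum_noncrossingCumulant_one (π : SetPartition n) (X : Fin n → A) (h : ∀ k, X k = 1) :
    ∑ σ ∈ noncrossingBelow π, E.noncrossingCumulant σ X = 1 := by
  let o : NoncrossingPartition n := ⟨⊥, by
    rintro ⟨i, j, k, l, hij, hjk, -, ⟨B, hB, hi, hk⟩, -⟩
    rw [Finpartition.mem_bot_iff] at hB
    obtain ⟨a, -, rfl⟩ := hB
    rw [mem_singleton] at hi hk
    exact absurd (hi.trans hk.symm) (hij.trans hjk).ne⟩
  have hzero : ∀ σ : NoncrossingPartition n, σ ≠ o → E.noncrossingCumulant σ X = 0 := by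
    intro σ hσ
    by_contra hne
    refine hσ (Subtype.ext (le_bot_iff.1 (le_iff_sameBlock.2 fun i a hia => ?_)))
    by_cases hai : a = i
    · rw [hai]
      exact SameBlock.refl _ i
    · exact absurd (E.noncrossingCumulant_eq_zero_of_eq_one X i (h i) σ hia hai) hne
  have hsum : ∀ π : SetPartition n,
      ∑ σ ∈ noncrossingBelow π, E.noncrossingCumulant σ X = E.noncrossingCumulant o X := by
    intro π
    apply Finset.sum_eq_single o (fun σ _ hσ => hzero σ hσ)
    exact fun hn => absurd (mem_noncrossingBelow.2 bot_le) hn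
  rw [hsum π, ← hsum o.1, sum_noncrossingCumulant, E.moment_eq_one _ X h]

/-- For free copies every partitioned moment is the sum of the noncrossing cumulants below it. -/
theorem IsFree.moment_eq_sum {E : ExchangeabilitySystem.{u, v} φ} (hE : E.IsFree) (hφ : φ 1 = 1)
    (π : SetPartition n) (X : Fin n → A) :
    E.moment π X = ∑ σ ∈ noncrossingBelow π, E.noncrossingCumulant σ X := by
  refine sub_eq_zero.1 (eq_zero_of_alternating hφ π
    (fun X => E.moment π X - ∑ σ ∈ noncrossingBelow π, E.noncrossingCumulant σ X)
    ((E.isCentrable_moment π).sub (IsCentrable.sum _ E.isCentrable_noncrossingCumulant)) ?_ ?_ X)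
  · intro X i j hij hs h
    rw [E.moment_merge π X hij hs h, E.sum_noncrossingCumulant_merge π X hij hs h]
  · intro S X h₁ h₀ halt
    rcases S.eq_empty_or_nonempty with rfl | hS
    · have h : ∀ k, X k = 1 := fun k => h₁ k (notMem_empty k)
      rw [E.moment_eq_one π X h, E.sum_noncrossingCumulant_one π X h, sub_self]
    · -- the moments of all partitions finer than `π` vanish, and with them the cumulants
      rw [hE.moment_eq_zero π S hS X h₁ h₀ halt, Finset.sum_eq_zero, sub_self]
      intro σ hσ
      apply Finset.sum_eq_zero
      intro τ hτ
      rw [hE.moment_eq_zero τ.1 S hS X h₁ h₀ (halt.mono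
        ((mem_noncrossingBelow.1 hτ).trans (mem_noncrossingBelow.1 hσ))), zero_mul]

open Classical in
/-- The cumulants are determined by the moments through Möbius inversion over all partitions, so
that they are the noncrossing cumulants, extended by zero. -/
theorem IsFree.cumulant_eq {E : ExchangeabilitySystem.{u, v} φ} (hE : E.IsFree) (hφ : φ 1 = 1)
    (π : SetPartition n) (X : Fin n → A) :
    E.cumulant π X = if h : ¬ HasCrossing π then E.noncrossingCumulant ⟨π, h⟩ X else 0 := by
  refine moebius_transform_sum (g := fun π => E.moment π X)
    (f := fun π => if h : ¬ HasCrossing π then E.noncrossingCumulant ⟨π, h⟩ X else 0) ?_ π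
  intro π
  rw [hE.moment_eq_sum hφ π X]
  refine Finset.sum_of_injOn Subtype.val Subtype.val_injective.injOn ?_ ?_ ?_
  · intro σ hσ
    simpa using mem_noncrossingBelow.1 hσ
  · intro σ hσ hn
    rw [dif_neg]
    intro h
    exact hn ⟨⟨σ, h⟩, mem_noncrossingBelow.2 (by simpa using hσ), rfl⟩
  · intro σ _
    rw [dif_pos σ.2]

theorem IsFree.cumulant_noncrossing {E : ExchangeabilitySystem.{u, v} φ} (hE : E.IsFree)
    (hφ : φ 1 = 1) (σ : NoncrossingPartition n) (X : Fin n → A) :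
    E.cumulant σ.1 X = E.noncrossingCumulant σ X := by
  rw [hE.cumulant_eq hφ, dif_pos σ.2]

end ExchangeabilitySystem

end NoncrossingCumulants

end FreeCumulants

theorem mainTheorem7 {A : Type u} [Ring A] [Algebra ℂ A]
    (φ : A →ₗ[ℂ] ℂ) (hφ : φ 1 = 1) :
    -- the free product of copies of `(A, φ)` is an exchangeability system with free copies
    (FreeCumulants.freeSystem φ hφ).IsFree ∧
    -- and for every such exchangeability system:
    ∀ E : FreeCumulants.ExchangeabilitySystem.{u, v} φ, E.IsFree →
      ∀ (n : ℕ) (X : Fin n → A),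
        -- crossing cumulants vanish
        (∀ π : FreeCumulants.SetPartition n, FreeCumulants.HasCrossing π → E.cumulant π X = 0) ∧
        -- partitioned moments are sums of noncrossing cumulants
        (∀ π : FreeCumulants.SetPartition n,
          E.moment π X = ∑ σ ∈ FreeCumulants.noncrossingBelow π, E.cumulant σ.1 X) ∧
        φ (List.ofFn X).prod = ∑ σ : FreeCumulants.NoncrossingPartition n, E.cumulant σ.1 X ∧
        -- Speicher's formula, with the Möbius function of the noncrossing partitions
        (∀ π : FreeCumulants.NoncrossingPartition n,
          E.cumulant π.1 X = ∑ σ ∈ FreeCumulants.noncrossingBelow π.1,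
            E.moment σ.1 X * FreeCumulants.moebius σ π) ∧
        -- in which the moments factorize
        (∀ σ : FreeCumulants.NoncrossingPartition n,
          E.moment σ.1 X = ∏ B ∈ σ.1.parts, φ (FreeCumulants.orderedProd B X)) := by
  classical
  refine ⟨(FreeCumulants.freeProductState_spec φ hφ).areFree, fun E hE n X => ?_⟩
  have hmom : ∀ π : FreeCumulants.SetPartition n,
      E.moment π X = ∑ σ ∈ FreeCumulants.noncrossingBelow π, E.cumulant σ.1 X := by
    intro π
    rw [hE.moment_eq_sum hφ π X]
    exact Finset.sum_congr rfl fun σ _ => (hE.cumulant_noncrossing hφ σ X).symm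
  refine ⟨fun π hπ => ?_, hmom, ?_, fun π => hE.cumulant_noncrossing hφ π X,
    fun σ => hE.moment_eq_prod hφ σ.2 X⟩
  · rw [hE.cumulant_eq hφ, dif_neg (not_not.2 hπ)]
  · have hsame := FreeCumulants.sameBlock_ofRel (n := n) (r := fun _ _ => True)
      ⟨fun _ => trivial, fun _ => trivial, fun _ _ => trivial⟩
    rw [← E.moment_of_single_block _ (fun i j => (hsame i j).2 trivial) X, hmom]
    refine Finset.sum_congr (Finset.eq_univ_of_forall fun σ => ?_) fun _ _ => rfl
    exact FreeCumulants.mem_noncrossingBelow.2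
      (FreeCumulants.le_iff_sameBlock.2 fun i j _ => (hsame i j).2 trivial)
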